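/- Let $k>1$ and $q>2$ be integers, let $d\ge 1$ be a squarefree natural number, and let $\mathbb{K}=\mathbb{Q}(i\sqrt d)\subset\mathbb{C}$. Let $\zeta_q=e^{2\pi i/q}$ and assume that $\mathbb{K}\cap\mathbb{Q}(\zeta_q)=\mathbb{Q}(i\sqrt d)$ (that is, $\mathbb{K}\subseteq\mathbb{Q}(\zeta_q)$). For real $0<x\le 1$ write $\zeta(k,x)=\sum_{n=0}^{\infty}(n+x)^{-k}$ for the Hurwitz zeta value. Let $V_{ar}(\mathbb{K})\subset\mathbb{C}$ be the $\mathbb{K}$-linear span of the numbers $$\zeta(k,a/q)+(-1)^k\,\zeta(k,1-a/q),\qquad 1\le a<q/2,\ \gcd(a,q)=1,$$ and let $\widehat{V}_k(q,\mathbb{K})\subset\mathbb{C}$ be the $\mathbb{K}$-linear span of $1$ and the numbers $$\zeta(k,a/q),\qquad 1\le a<q,\ \gcd(a,q)=1.$$ Then, with $\varphi$ denoting Euler's totient function, $$\dim_{\mathbb{K}}V_{ar}(\mathbb{K})=\frac{\varphi(q)}{2},$$ and therefore $$\dim_{\mathbb{K}}\widehat{V}_k(q,\mathbb{K})\ge\frac{\varphi(q)}{2}+1.$$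 -/

import Mathlib

namespace HurwitzSpaces

/-- The Hurwitz zeta value `ζ(s, x)` for a real parameter `0 < x ≤ 1`. For `1 < re s` it is the sum
of the series `∑ 1 / (n + x) ^ s` over `n ≥ 0` (see `hasSum_zetaH`). -/
noncomputable def zetaH (s : ℂ) (x : ℝ) : ℂ :=
  HurwitzZeta.hurwitzZeta (x : UnitAddCircle) s

theorem hasSum_zetaH {s : ℂ} (hs : 1 < s.re) {x : ℝ} (hx : x ∈ Set.Ioc (0 : ℝ) 1) :
    HasSum (fun n : ℕ => 1 / ((n : ℂ) + (x : ℂ)) ^ s) (zetaH s x) :=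
  HurwitzZeta.hasSum_hurwitzZeta_of_one_lt_re ⟨hx.1.le, hx.2⟩ hs

/-- The field `ℚ(i√d)` as a subfield of `ℂ`. -/
noncomputable def imagQuadField (d : ℕ) : IntermediateField ℚ ℂ :=
  IntermediateField.adjoin ℚ {Complex.I * (Real.sqrt d : ℂ)}

/-- The cyclotomic field `ℚ(ζ_q)` as a subfield of `ℂ`, with `ζ_q = exp (2πi/q)`. -/
noncomputable def cyclotomicSubfield (q : ℕ) : IntermediateField ℚ ℂ :=
  IntermediateField.adjoin ℚ {Complex.exp (2 * Real.pi * Complex.I / q)}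

/-- The `K`-linear span of `1` and the values `ζ(k, a/q)`, `1 ≤ a < q`, `(a, q) = 1`. -/
noncomputable def extendedSpace (k q : ℕ) (K : IntermediateField ℚ ℂ) : Submodule K ℂ :=
  Submodule.span K
    ({1} ∪ {z : ℂ | ∃ a : ℕ, 1 ≤ a ∧ a < q ∧ Nat.Coprime a q ∧ z = zetaH k ((a : ℝ) / q)})

/-- The arithmetic space: the `K`-linear span of the numbers `ζ(k, a/q) + (-1)^k ζ(k, 1 - a/q)`,
`1 ≤ a < q/2`, `(a, q) = 1`. -/
noncomputable def arithmeticSpace (k q : ℕ) (K : IntermediateField ℚ ℂ) : Submodule K ℂ :=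
  Submodule.span K
    {z : ℂ | ∃ a : ℕ, 1 ≤ a ∧ (a : ℝ) < (q : ℝ) / 2 ∧ Nat.Coprime a q ∧
      z = zetaH k ((a : ℝ) / q) + (-1) ^ k * zetaH k (1 - (a : ℝ) / q)}

end HurwitzSpaces

/-! Evaluating the Fourier series of the Bernoulli polynomial `B_k` at the points `b/q` and
inverting modulo `q` shows that each reflected value `R(j) = ζ(k, j/q) + (-1)^k ζ(k, -j/q)` is a
fixed nonzero rational multiple of `(2πi)^k` times an element of `ℚ(ζ_q)`, on which the automorphism
`ζ_q ↦ ζ_q^t` acts by `j ↦ tj` (`reflectedHurwitz_eq`). A rational relation `∑ c(a) R(a) = 0` over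
the units thus yields `∑ c(a) R(ta) = 0` for every unit `t`. Averaging against a character `χ`
factors this as `(∑ c(a) χ⁻¹(a)) (1 + (-1)^k χ(-1)) q^k L(k, χ) = 0`. Since `L(k, χ) ≠ 0`, character
inversion gives `c(b) + (-1)^k c(-b) = 0` (`coeff_add_coeff_neg_eq_zero`): the parity of `R` is the
only source of relations, and none is left among the `φ(q)/2` classes below `q/2`.

The number `1` is independent of these values because `π^k` is transcendental, which is proved here
by Lindemann's method. Finally, all these numbers are real, so taking real and imaginary parts
carries independence from `ℚ` to `ℚ(i√d)` (`linearIndependent_imagQuadField_of_real`). -/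

namespace HurwitzSpaces

/-! ### Transcendence of `π` -/

section TranscendencePi

open Polynomial

theorem isIntegral_pow_mul_aeval {A : Type*} [CommRing A] {m : ℤ} {x : A}
    (hx : IsIntegral ℤ (m * x)) (g : ℤ[X]) {E : ℕ}
    (hE : g.natDegree ≤ E) : IsIntegral ℤ ((m : A) ^ E * aeval x g) := by
  rw [aeval_eq_sum_range' (Nat.lt_succ_of_le hE), Finset.mul_sum]
  refine IsIntegral.sum _ fun j hj => ?_
  have hj : j ≤ E := Nat.lt_succ_iff.1 (Finset.mem_range.1 hj)
  have : (m : A) ^ E * g.coeff j • x ^ j =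
      algebraMap ℤ A (g.coeff j * m ^ (E - j)) * (m * x) ^ j := by
    rw [zsmul_eq_mul]
    conv_lhs => rw [← Nat.sub_add_cancel hj, pow_add]
    simp
    ring
  rw [this]
  exact isIntegral_algebraMap.mul (hx.pow j)

variable {L : Type*} [Field L] [Algebra ℚ L] [FiniteDimensional ℚ L] [IsGalois ℚ L]

theorem exists_rat_of_forall_galois_eq {x : L} (h : ∀ σ : Gal(L/ℚ), σ x = x) :
    ∃ r : ℚ, algebraMap ℚ L r = x :=
  IntermediateField.mem_bot.1 ((IsGalois.mem_bot_iff_fixed x).2 h)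

theorem exists_int_of_forall_galois_eq {x : L} (hx : IsIntegral ℤ x)
    (h : ∀ σ : Gal(L/ℚ), σ x = x) : ∃ z : ℤ, (z : L) = x := by
  obtain ⟨r, rfl⟩ := exists_rat_of_forall_galois_eq h
  have hr : IsIntegral ℤ r :=
    (isIntegral_algebraMap_iff (algebraMap ℚ L).injective).1 hx
  obtain ⟨z, rfl⟩ := IsIntegrallyClosed.isIntegral_iff.1 hr
  exact ⟨z, by simp⟩

theorem exists_map_eq_prod_X_sub_C {M : Multiset L} (hM : ∀ σ : Gal(L/ℚ), M.map σ = M) :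
    ∃ F : ℚ[X], F.map (algebraMap ℚ L) = (M.map fun γ => X - C γ).prod := by
  have h : ∀ n, ∃ r : ℚ, algebraMap ℚ L r = ((M.map fun γ => X - C γ).prod).coeff n := by
    intro n
    refine exists_rat_of_forall_galois_eq fun σ => ?_
    have : ((M.map fun γ => X - C γ).prod).map (σ : L →+* L) = (M.map fun γ => X - C γ).prod := by
      rw [Polynomial.map_multiset_prod, Multiset.map_map]
      conv_rhs => rw [← hM σ, Multiset.map_map]
      simp
    conv_rhs => rw [← this, coeff_map]
    rfl
  have : (M.map fun γ => X - C γ).prod ∈ lifts (algebraMap ℚ L) := by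
    rw [lifts_iff_coeff_lifts]
    exact fun n => h n
  exact (mem_lifts _).1 this

theorem exists_int_eq_pow_mul_sum_aeval {M : Multiset L} (hM : ∀ σ : Gal(L/ℚ), M.map σ = M)
    {m : ℤ} (hm : ∀ γ ∈ M, IsIntegral ℤ ((m : L) * γ)) (g : ℤ[X]) {E : ℕ}
    (hE : g.natDegree ≤ E) :
    ∃ z : ℤ, (z : L) = (m : L) ^ E * (M.map fun γ => aeval γ g).sum := by
  refine exists_int_of_forall_galois_eq ?_ fun σ => ?_
  · rw [← Multiset.sum_map_mul_left]
    refine IsIntegral.multiset_sum fun y hy => ?_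
    obtain ⟨γ, hγ, rfl⟩ := Multiset.mem_map.1 hy
    exact isIntegral_pow_mul_aeval (hm γ hγ) g hE
  · have h : σ (M.map fun γ => aeval γ g).sum = (M.map fun γ => aeval γ g).sum := by
      rw [map_multiset_sum, Multiset.map_map]
      conv_rhs => rw [← hM σ, Multiset.map_map]
      congr 1
      refine Multiset.map_congr rfl fun γ _ => ?_
      exact (aeval_algHom_apply ((σ : L →ₐ[ℚ] L).restrictScalars ℤ) γ g).symm
    rw [map_mul, map_pow, map_intCast, h]

/-- The coefficients of `∏ (X - γ)` are Galois-fixed, hence rational; clear their denominators. The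
nonzero constant term is what `LindemannWeierstrass.exp_polynomial_approx` requires. -/
theorem exists_int_polynomial_of_galois_invariant {M : Multiset L} (h0 : (0 : L) ∉ M)
    (hM : ∀ σ : Gal(L/ℚ), M.map σ = M) :
    ∃ f : ℤ[X], f.eval 0 ≠ 0 ∧ ∀ γ ∈ M, aeval γ f = 0 := by
  obtain ⟨F, hF⟩ := exists_map_eq_prod_X_sub_C hM
  obtain ⟨b, hb, hf⟩ := IsLocalization.integerNormalization_spec (nonZeroDivisors ℤ) F
  set f := IsLocalization.integerNormalization (nonZeroDivisors ℤ) F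
  have : CharZero L := algebraRat.charZero L
  have hb0 : (b : L) ≠ 0 := by exact_mod_cast nonZeroDivisors.ne_zero hb
  have key : ∀ x : L, aeval x f = (b : L) * (M.map fun γ => x - γ).prod := by
    intro x
    have h1 : aeval x f = aeval x (f.map (algebraMap ℤ ℚ)) := by
      rw [aeval_map_algebraMap]
    rw [h1, hf, map_zsmul, zsmul_eq_mul, ← eval_map_algebraMap, hF, eval_multiset_prod,
      Multiset.map_map]
    simp
  refine ⟨f, fun h => ?_, fun γ hγ => ?_⟩
  · have h1 : aeval (0 : L) f = 0 := by
      rw [aeval_def, eval₂_at_zero, coeff_zero_eq_eval_zero, h, map_zero]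
    rw [key, mul_eq_zero, Multiset.prod_eq_zero_iff] at h1
    rcases h1 with h1 | h1
    · exact hb0 h1
    · obtain ⟨γ, hγ, h2⟩ := Multiset.mem_map.1 h1
      rw [zero_sub, neg_eq_zero] at h2
      exact h0 (h2 ▸ hγ)
  · rw [key, Multiset.prod_eq_zero, mul_zero]
    exact Multiset.mem_map.2 ⟨γ, hγ, sub_self γ⟩

theorem exists_prime_pow_div_factorial_lt (D m c : ℝ) (e B : ℕ) :
    ∃ p : ℕ, p.Prime ∧ B < p ∧ D * m ^ (p * e) * (c ^ p / (p - 1).factorial) < 1 := by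
  have h := (FloorSemiring.tendsto_pow_div_factorial_atTop (m ^ e * c)).const_mul
    (D * (m ^ e * c))
  rw [mul_zero] at h
  obtain ⟨n, hn⟩ := Filter.eventually_atTop.1 (h.eventually (gt_mem_nhds zero_lt_one))
  obtain ⟨p, hp, hprime⟩ := Nat.exists_infinite_primes (n + B + 1)
  refine ⟨p, hprime, by omega, ?_⟩
  have := hn (p - 1) (by omega)
  obtain ⟨r, rfl⟩ : ∃ r, p = r + 1 := ⟨p - 1, by omega⟩
  rw [Nat.add_sub_cancel] at *
  refine lt_of_eq_of_lt ?_ this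
  rw [mul_comm (r + 1) e, pow_mul, pow_succ (m ^ e), pow_succ c, mul_pow]
  ring

/-- A positive integer plus a sum of exponentials over a Galois-stable multiset of nonzero
algebraic numbers does not vanish. -/
theorem natCast_add_sum_exp_ne_zero (φ : L →+* ℂ) {M : Multiset L} (h0 : (0 : L) ∉ M)
    (hM : ∀ σ : Gal(L/ℚ), M.map σ = M) {N : ℕ} (hN : 0 < N) :
    (N : ℂ) + (M.map fun γ => Complex.exp (φ γ)).sum ≠ 0 := by
  intro hsum
  obtain ⟨f, hf0, hfM⟩ := exists_int_polynomial_of_galois_invariant h0 hM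
  have hfne : f ≠ 0 := by rintro rfl; simp at hf0
  set m : ℤ := f.leadingCoeff with hm_def
  have hm : m ≠ 0 := leadingCoeff_ne_zero.2 hfne
  obtain ⟨c, hc⟩ := LindemannWeierstrass.exp_polynomial_approx f hf0
  -- A prime this large divides none of `N`, `m`, `f(0)`.
  obtain ⟨p, hp, hpB, hsmall⟩ := exists_prime_pow_div_factorial_lt (M.card : ℝ) |(m : ℝ)| c
    f.natDegree (N + m.natAbs + (f.eval 0).natAbs)
  obtain ⟨n, hn, g, hgdeg, hg⟩ := hc p (by omega) hp
  obtain ⟨z, hz⟩ := exists_int_eq_pow_mul_sum_aeval hM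
    (fun γ hγ => by simpa using isIntegral_leadingCoeff_smul f γ (hfM γ hγ)) g
    (hgdeg.trans (Nat.sub_le _ _))
  set E := p * f.natDegree
  have haev : ∀ γ : L, φ (aeval γ g) = aeval (φ γ) g := fun γ =>
    (aeval_algHom_apply (RingHom.toIntAlgHom φ) γ g).symm
  have hz' : (z : ℂ) = (m : ℂ) ^ E * (M.map fun γ => aeval (φ γ) g).sum := by
    have := congrArg φ hz
    rw [map_intCast, map_mul, map_pow, map_intCast, map_multiset_sum, Multiset.map_map] at this
    simpa [Function.comp_def, haev] using this
  -- Replacing `N` by minus the sum of exponentials turns this integer into a sum of Hermite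
  -- approximation errors. It has absolute value below 1, so it is zero, although `p ∤ n N m^E`.
  have heq : ((n * N * m ^ E + p * z : ℤ) : ℂ) =
      -((m : ℂ) ^ E * (M.map fun γ => n • Complex.exp (φ γ) - p • aeval (φ γ) g).sum) := by
    rw [Multiset.sum_map_sub, Multiset.sum_map_nsmul]
    have h1 : (M.map fun γ => n • Complex.exp (φ γ)).sum = -(n * N : ℂ) := by
      rw [Multiset.sum_map_zsmul, eq_neg_of_add_eq_zero_right hsum]
      simp
    rw [h1]
    push_cast
    rw [hz', nsmul_eq_mul]
    ring
  have hbound : ‖((n * N * m ^ E + p * z : ℤ) : ℂ)‖ < 1 := by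
    refine lt_of_le_of_lt ?_ hsmall
    rw [heq, norm_neg, norm_mul, norm_pow, Complex.norm_intCast, mul_comm (M.card : ℝ),
      mul_assoc]
    gcongr
    refine (norm_multiset_sum_le _).trans ?_
    rw [Multiset.map_map]
    refine (Multiset.sum_le_card_nsmul _ (c ^ p / (p - 1).factorial) ?_).trans ?_
    · intro x hx
      obtain ⟨γ, hγ, rfl⟩ := Multiset.mem_map.1 hx
      refine hg ((mem_aroots).2 ⟨hfne, ?_⟩)
      have := congrArg φ (hfM γ hγ)
      rw [map_zero] at this
      rw [← this]
      exact aeval_algHom_apply (RingHom.toIntAlgHom φ) γ f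
    · simp
  have hzero : n * N * m ^ E + p * z = 0 := by
    rw [Complex.norm_intCast] at hbound
    have : |n * N * m ^ E + p * z| < 1 := by exact_mod_cast hbound
    exact Int.abs_lt_one_iff.1 this
  have hdvd : (p : ℤ) ∣ n * N * m ^ E :=
    (dvd_add_left (dvd_mul_right (p : ℤ) z)).1 (hzero ▸ dvd_zero _)
  have hpZ := Nat.prime_iff_prime_int.1 hp
  rcases hpZ.dvd_or_dvd hdvd with h | h
  · rcases hpZ.dvd_or_dvd h with h | h
    · exact hn h
    · have := Nat.le_of_dvd hN (Int.natCast_dvd_natCast.1 h)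
      omega
  · have := Nat.le_of_dvd (Int.natAbs_pos.2 hm) (Int.natCast_dvd.1 (hpZ.dvd_of_dvd_pow h))
    omega

/-- If `e^x = -1`, the product of `1 + e^β` over the conjugates `β` of `x` vanishes. Expanded, it is
a sum of exponentials of subset sums: the zero sums contribute a positive integer, the others form a
Galois-stable multiset. -/
theorem exp_ne_neg_one_of_isAlgebraic {x : ℂ} (hx : IsAlgebraic ℚ x) :
    Complex.exp x ≠ -1 := by
  classical
  intro hexp
  have hint : IsIntegral ℚ x := hx.isIntegral
  set P := minpoly ℚ x
  have hsep : P.Separable := (minpoly.irreducible hint).separable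
  let L := P.SplittingField
  have : IsSplittingField ℚ L P := IsSplittingField.splittingField P
  have : IsGalois ℚ L := IsGalois.of_separable_splitting_field hsep
  have hP0 : P ≠ 0 := minpoly.ne_zero hint
  let φ : L →ₐ[ℚ] ℂ := SplittingField.lift P (IsAlgClosed.splits _)
  let R : Finset L := (P.aroots L).toFinset
  have hmemR : ∀ y, y ∈ R ↔ aeval y P = 0 := fun y => by
    simp [R, hP0]
  obtain ⟨y, hy, hyx⟩ : ∃ y ∈ R, φ y = x := by
    have hs : (P.map (algebraMap ℚ L)).Splits := SplittingField.splits P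
    have hroots : (P.aroots L).map φ = P.aroots ℂ := by
      have := hs.roots_map (φ : L →+* ℂ)
      rw [Polynomial.map_map] at this
      have h2 : (φ : L →+* ℂ).comp (algebraMap ℚ L) = algebraMap ℚ ℂ := φ.comp_algebraMap
      rw [h2] at this
      exact this.symm
    have hxr : x ∈ P.aroots ℂ := by
      rw [mem_aroots]; exact ⟨hP0, minpoly.aeval ℚ x⟩
    rw [← hroots, Multiset.mem_map] at hxr
    obtain ⟨y, hy, hyx⟩ := hxr
    exact ⟨y, by simpa [R] using hy, hyx⟩
  have hprod : ∏ β ∈ R, (1 + Complex.exp (φ β)) = 0 :=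
    Finset.prod_eq_zero hy (by rw [hyx, hexp]; ring)
  rw [Finset.prod_one_add] at hprod
  have hσR : ∀ σ : Gal(L/ℚ), R.map (σ : L ≃ L).toEmbedding = R := by
    intro σ
    refine Finset.eq_of_subset_of_card_le (fun z hz => ?_) (by simp)
    obtain ⟨w, hw, rfl⟩ := Finset.mem_map.1 hz
    rw [hmemR] at hw ⊢
    have := aeval_algHom_apply (σ : L →ₐ[ℚ] L) w P
    rw [hw, map_zero] at this
    exact this
  let T := R.powerset.filter fun t => ∑ β ∈ t, β ≠ 0
  let T' := R.powerset.filter fun t => ¬ ∑ β ∈ t, β ≠ 0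
  let M : Multiset L := T.val.map fun t => ∑ β ∈ t, β
  refine natCast_add_sum_exp_ne_zero (φ : L →+* ℂ) (M := M) (N := T'.card) ?_ ?_ ?_ ?_
  · intro h
    obtain ⟨t, ht, h0⟩ := Multiset.mem_map.1 h
    exact (Finset.mem_filter.1 ht).2 h0
  · intro σ
    have hsum : ∀ t : Finset L, ∑ β ∈ t.map (σ : L ≃ L).toEmbedding, β = σ (∑ β ∈ t, β) := by
      intro t
      rw [Finset.sum_map, map_sum]
      rfl
    have hT : T.map (Finset.mapEmbedding (σ : L ≃ L).toEmbedding).toEmbedding = T := by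
      refine Finset.eq_of_subset_of_card_le (fun z hz => ?_) (by simp)
      obtain ⟨t, ht, rfl⟩ := Finset.mem_map.1 hz
      simp only [T, Finset.mem_filter, Finset.mem_powerset] at ht ⊢
      refine ⟨?_, ?_⟩
      · conv_rhs => rw [← hσR σ]
        exact Finset.map_subset_map.2 ht.1
      · change ∑ β ∈ t.map (σ : L ≃ L).toEmbedding, β ≠ 0
        rw [hsum]
        exact fun h => ht.2 ((map_eq_zero σ).1 h)
    have : M = (T.map (Finset.mapEmbedding (σ : L ≃ L).toEmbedding).toEmbedding).val.map
        fun t => ∑ β ∈ t, β := by rw [hT]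
    conv_rhs => rw [this]
    rw [Finset.map_val, Multiset.map_map, Multiset.map_map]
    exact Multiset.map_congr rfl fun t _ => (hsum t).symm
  -- The empty subset has sum zero.
  · exact Finset.card_pos.2 ⟨∅, by simp [T']⟩
  · rw [← hprod, ← Finset.sum_filter_add_sum_filter_not R.powerset (fun t => ∑ β ∈ t, β ≠ 0),
      add_comm]
    congr 1
    · change ((T.val.map _).map _).sum = _
      rw [Multiset.map_map]
      refine Finset.sum_congr rfl fun t _ => ?_
      simp [Complex.exp_sum]
    · rw [Finset.sum_congr rfl (g := fun _ => (1 : ℂ))]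
      · simp [T']
      · intro t ht
        have h0 : ∑ β ∈ t, β = 0 := not_not.1 (Finset.mem_filter.1 ht).2
        rw [← Complex.exp_sum, ← map_sum, h0, map_zero, Complex.exp_zero]

/-- Lindemann's theorem: `π` is transcendental. -/
theorem transcendental_pi : Transcendental ℚ (Real.pi : ℂ) := by
  intro h
  have hI : IsAlgebraic ℚ Complex.I :=
    ⟨X ^ 2 + 1, by
      intro h
      have := congrArg (eval 0) h
      simp at this, by simp⟩
  exact exp_ne_neg_one_of_isAlgebraic (h.mul hI) Complex.exp_pi_mul_I

end TranscendencePi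

/-! ### Reflected Hurwitz values, Bernoulli values and rational relations -/

section ReflectedHurwitz

variable {q : ℕ}

/-- The value `B_k(b/q)` of the Bernoulli polynomial, for `b` reduced modulo `q`. -/
noncomputable def bernoulliValue (k : ℕ) (b : ZMod q) : ℚ :=
  (Polynomial.bernoulli k).eval ((b.val : ℚ) / q)

theorem bernoulliFun_val_div (k : ℕ) (b : ZMod q) :
    bernoulliFun k ((b.val : ℝ) / q) = bernoulliValue k b := by
  rw [bernoulliFun, bernoulliValue]
  have : ((b.val : ℝ) / q) = algebraMap ℚ ℝ ((b.val : ℚ) / q) := by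
    rw [map_div₀, map_natCast, map_natCast]
  rw [this, Polynomial.eval_map_apply]
  rfl

variable [NeZero q]

/-- The value `ζ(k, j/q) + (-1)^k ζ(k, -j/q)` as a function of the residue class `j`. -/
noncomputable def reflectedHurwitz (k : ℕ) (j : ZMod q) : ℂ :=
  HurwitzZeta.hurwitzZeta (ZMod.toAddCircle j) k +
    (-1) ^ k * HurwitzZeta.hurwitzZeta (ZMod.toAddCircle (-j)) k

/-- The discrete Fourier transform of `b ↦ B_k(b/q)`. -/
noncomputable def bernoulliFourier (k : ℕ) (j : ZMod q) : ℂ :=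
  ∑ b : ZMod q, ZMod.stdAddChar (-(j * b)) * (bernoulliValue k b : ℂ)

theorem toAddCircle_eq_val_div (j : ZMod q) :
    ZMod.toAddCircle j = (((j.val : ℝ) / q : ℝ) : UnitAddCircle) := by
  rw [← ZMod.toAddCircle_natCast, ZMod.natCast_zmod_val]

theorem fourier_val_div (n : ℤ) (b : ZMod q) :
    fourier n (((b.val : ℝ) / q : ℝ) : UnitAddCircle) = ZMod.stdAddChar ((n : ZMod q) * b) := by
  have h : (n : ZMod q) * b = ((n * b.val : ℤ) : ZMod q) := by simp
  rw [h, ZMod.stdAddChar_coe, fourier_coe_apply]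
  congr 1
  push_cast
  ring

theorem sum_stdAddChar_mul_stdAddChar (j n : ZMod q) :
    ∑ b : ZMod q, (ZMod.stdAddChar (-(j * b)) : ℂ) * ZMod.stdAddChar (n * b) =
      if n = j then (q : ℂ) else 0 := by
  have h := AddChar.sum_mulShift (n - j) (ZMod.isPrimitive_stdAddChar q)
  rw [ZMod.card] at h
  simp only [sub_eq_zero, Nat.cast_ite, Nat.cast_zero] at h
  rw [← h]
  refine Finset.sum_congr rfl fun b _ => ?_
  rw [← AddChar.map_add_eq_mul]
  congr 1
  ring

theorem hasSum_ite_one_div_pow {k : ℕ} (hk : 1 < k) {j : ZMod q} (hj : j ≠ 0) :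
    HasSum (fun n : ℕ => if (n : ZMod q) = j then 1 / (n : ℂ) ^ k else 0)
      (((q : ℂ) ^ k)⁻¹ * HurwitzZeta.hurwitzZeta (ZMod.toAddCircle j) k) := by
  have hq : (q : ℂ) ≠ 0 := NeZero.ne _
  have hqR : (0 : ℝ) < q := Nat.cast_pos.2 (NeZero.pos q)
  have hinj : Function.Injective fun m : ℕ => q * m + j.val := by
    intro a b h
    simpa [NeZero.ne q] using h
  rw [← hinj.hasSum_iff]
  · have hx : (j.val : ℝ) / q ∈ Set.Icc (0 : ℝ) 1 :=
      ⟨by positivity, (div_le_one hqR).2 (by exact_mod_cast (ZMod.val_lt j).le)⟩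
    have h := (HurwitzZeta.hasSum_hurwitzZeta_of_one_lt_re hx (s := k)
      (by simpa using hk)).mul_left ((q : ℂ) ^ k)⁻¹
    rw [toAddCircle_eq_val_div]
    refine h.congr_fun ?_
    intro m
    simp only [Function.comp]
    rw [if_pos (by simp), Complex.cpow_natCast]
    push_cast
    rw [one_div, one_div, ← mul_inv, ← mul_pow, mul_add, mul_div_cancel₀ _ hq]
  · intro n hn
    rw [if_neg]
    rintro rfl
    refine hn ⟨n / q, ?_⟩
    simp only [ZMod.val_natCast]
    exact Nat.div_add_mod n q

/-- Twist the Fourier series of `B_k` at `b/q` by `ζ_q^(-jb)` and sum over `b`: orthogonality keeps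
only the frequencies `n ≡ ±j`, which form the two Hurwitz series. -/
theorem bernoulliFourier_eq {k : ℕ} (hk : 1 < k) {j : ZMod q} (hj : j ≠ 0) :
    -(2 * Real.pi * Complex.I) ^ k / k.factorial * bernoulliFourier k j =
      q * ((q : ℂ) ^ k)⁻¹ * reflectedHurwitz k j := by
  have hqR : (0 : ℝ) < q := Nat.cast_pos.2 (NeZero.pos q)
  have hx (b : ZMod q) : (b.val : ℝ) / q ∈ Set.Icc (0 : ℝ) 1 :=
      ⟨by positivity, (div_le_one hqR).2 (by exact_mod_cast (ZMod.val_lt b).le)⟩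
  have h1 := hasSum_sum (s := Finset.univ) fun (b : ZMod q) _ =>
    (hasSum_one_div_nat_pow_mul_fourier hk (hx b)).mul_left (ZMod.stdAddChar (-(j * b)) : ℂ)
  have h2 := ((hasSum_ite_one_div_pow hk hj).add
    ((hasSum_ite_one_div_pow hk (neg_ne_zero.2 hj)).mul_left ((-1) ^ k))).mul_left (q : ℂ)
  have h3 := h1.unique (h2.congr_fun ?_)
  · rw [reflectedHurwitz, bernoulliFourier, Finset.mul_sum]
    have h4 : ∀ b : ZMod q, -(2 * Real.pi * Complex.I) ^ k / k.factorial *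
        ((ZMod.stdAddChar (-(j * b)) : ℂ) * (bernoulliValue k b : ℂ)) =
        ZMod.stdAddChar (-(j * b)) * (-(2 * Real.pi * Complex.I) ^ k / k.factorial *
          (bernoulliFun k ((b.val : ℝ) / q) : ℂ)) := by
      intro b
      rw [bernoulliFun_val_div]
      push_cast
      ring
    rw [Finset.sum_congr rfl fun b _ => h4 b, h3]
    ring
  · intro n
    have h5 : ∀ b : ZMod q, (ZMod.stdAddChar (-(j * b)) : ℂ) *
        (1 / (n : ℂ) ^ k * (fourier (n : ℤ) (((b.val : ℝ) / q : ℝ) : UnitAddCircle) +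
          (-1) ^ k * fourier (-(n : ℤ)) (((b.val : ℝ) / q : ℝ) : UnitAddCircle))) =
        1 / (n : ℂ) ^ k *
          ((ZMod.stdAddChar (-(j * b)) : ℂ) * ZMod.stdAddChar ((n : ZMod q) * b)) +
        1 / (n : ℂ) ^ k * (-1) ^ k *
          ((ZMod.stdAddChar (-(j * b)) : ℂ) * ZMod.stdAddChar (-(n : ZMod q) * b)) := by
      intro b
      rw [fourier_val_div, fourier_val_div]
      push_cast
      ring
    rw [Finset.sum_congr rfl fun b _ => h5 b, Finset.sum_add_distrib, ← Finset.mul_sum,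
      ← Finset.mul_sum, sum_stdAddChar_mul_stdAddChar, sum_stdAddChar_mul_stdAddChar]
    simp only [neg_eq_iff_eq_neg]
    split_ifs <;> ring

/-- The transcendental factor of the reflected Hurwitz values. -/
noncomputable def reflectionFactor (q k : ℕ) : ℂ :=
  -(2 * Real.pi * Complex.I) ^ k * q ^ k / (q * k.factorial)

theorem reflectionFactor_ne_zero (k : ℕ) : reflectionFactor q k ≠ 0 := by
  have hq : (q : ℂ) ≠ 0 := NeZero.ne _
  have hpi : (Real.pi : ℂ) ≠ 0 := Complex.ofReal_ne_zero.2 Real.pi_ne_zero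
  simp [reflectionFactor, hq, hpi, Nat.factorial_ne_zero, Complex.I_ne_zero]

theorem reflectedHurwitz_eq {k : ℕ} (hk : 1 < k) {j : ZMod q} (hj : j ≠ 0) :
    reflectedHurwitz k j = reflectionFactor q k * bernoulliFourier k j := by
  have hq : (q : ℂ) ≠ 0 := NeZero.ne _
  have hf : (k.factorial : ℂ) ≠ 0 := by exact_mod_cast k.factorial_ne_zero
  have h := bernoulliFourier_eq hk hj
  rw [reflectionFactor]
  field_simp at h ⊢
  linear_combination -h

theorem sum_char_mul_reflectedHurwitz (χ : DirichletCharacter ℂ q) (k : ℕ) :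
    ∑ j : ZMod q, χ j * reflectedHurwitz k j =
      (1 + (-1) ^ k * χ (-1)) * (q ^ k * DirichletCharacter.LFunction χ k) := by
  have hq : (q : ℂ) ≠ 0 := NeZero.ne _
  have hL : (q : ℂ) ^ k * DirichletCharacter.LFunction χ k =
      ∑ j : ZMod q, χ j * HurwitzZeta.hurwitzZeta (ZMod.toAddCircle j) k := by
    rw [DirichletCharacter.LFunction, ZMod.LFunction, Complex.cpow_neg, Complex.cpow_natCast,
      mul_inv_cancel_left₀ (pow_ne_zero _ hq)]
  have hneg : ∑ j : ZMod q, χ j * HurwitzZeta.hurwitzZeta (ZMod.toAddCircle (-j)) k =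
      χ (-1) * ∑ j : ZMod q, χ j * HurwitzZeta.hurwitzZeta (ZMod.toAddCircle j) k := by
    rw [← Equiv.sum_comp (Equiv.neg (ZMod q)), Finset.mul_sum]
    refine Finset.sum_congr rfl fun j _ => ?_
    rw [Equiv.neg_apply, neg_neg, ← neg_one_mul j, map_mul, mul_assoc]
  simp only [reflectedHurwitz, mul_add, Finset.sum_add_distrib]
  rw [hL, add_mul, one_mul, mul_assoc, ← hneg, Finset.mul_sum]
  congr 1
  exact Finset.sum_congr rfl fun j _ => by ring

/-- Galois conjugation in polynomial form: `ζ` and `ζ^t` share the cyclotomic polynomial as minimal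
polynomial. -/
theorem aeval_pow_eq_zero_of_coprime {ζ : ℂ} (hζ : IsPrimitiveRoot ζ q) {t : ℕ}
    (ht : t.Coprime q) {P : Polynomial ℚ} (hP : Polynomial.aeval ζ P = 0) :
    Polynomial.aeval (ζ ^ t) P = 0 := by
  have hq : 0 < q := NeZero.pos q
  have h1 : minpoly ℚ ζ = minpoly ℚ (ζ ^ t) := by
    rw [← Polynomial.cyclotomic_eq_minpoly_rat hζ hq,
      ← Polynomial.cyclotomic_eq_minpoly_rat (hζ.pow_of_coprime t ht) hq]
  obtain ⟨Q, hQ⟩ := h1 ▸ minpoly.dvd ℚ ζ hP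
  rw [hQ, map_mul, minpoly.aeval, zero_mul]

theorem stdAddChar_mul_eq_pow (t j : ZMod q) :
    (ZMod.stdAddChar (t * j) : ℂ) = ((ZMod.stdAddChar (1 : ZMod q) : ℂ) ^ t.val) ^ j.val := by
  rw [← AddChar.map_nsmul_eq_pow, ← AddChar.map_nsmul_eq_pow]
  congr 1
  simp [mul_comm]

theorem isPrimitiveRoot_stdAddChar_one :
    IsPrimitiveRoot (ZMod.stdAddChar (1 : ZMod q) : ℂ) q := by
  have h := ZMod.stdAddChar_coe (N := q) 1
  rw [Int.cast_one] at h
  rw [h]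
  simpa using Complex.isPrimitiveRoot_exp q (NeZero.ne q)

theorem sum_mul_bernoulliFourier_unit_mul {k : ℕ} {c : (ZMod q)ˣ → ℚ}
    (h : ∑ a, (c a : ℂ) * bernoulliFourier k (a : ZMod q) = 0) (t : (ZMod q)ˣ) :
    ∑ a, (c a : ℂ) * bernoulliFourier k (t * a : ZMod q) = 0 := by
  -- `P` encodes the relation: its value at `ζ_q^t` is the relation with each `a` replaced by `t *
  -- a`.
  let P : Polynomial ℚ := ∑ a : (ZMod q)ˣ, ∑ b : ZMod q,
    Polynomial.C (c a * bernoulliValue k b) * Polynomial.X ^ (-((a : ZMod q) * b)).val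
  have hP (t : ZMod q) : Polynomial.aeval ((ZMod.stdAddChar (1 : ZMod q) : ℂ) ^ t.val) P =
      ∑ a : (ZMod q)ˣ, (c a : ℂ) * bernoulliFourier k (t * (a : ZMod q)) := by
    simp only [P, map_sum, map_mul, map_pow, Polynomial.aeval_X, Polynomial.aeval_C,
      ← stdAddChar_mul_eq_pow, bernoulliFourier, Finset.mul_sum]
    refine Finset.sum_congr rfl fun a _ => Finset.sum_congr rfl fun b _ => ?_
    rw [mul_neg, mul_assoc t a b]
    simp only [eq_ratCast]
    ring
  have hone : (ZMod.stdAddChar (1 : ZMod q) : ℂ) ^ (1 : ZMod q).val =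
      ZMod.stdAddChar (1 : ZMod q) := by
    rw [← AddChar.map_nsmul_eq_pow]
    simp
  rw [← hP]
  refine aeval_pow_eq_zero_of_coprime isPrimitiveRoot_stdAddChar_one
    (ZMod.val_coe_unit_coprime t) ?_
  rw [← hone, hP]
  simpa using h

theorem sum_mul_reflectedHurwitz_unit_mul [Fact (1 < q)] {k : ℕ} (hk : 1 < k)
    {c : (ZMod q)ˣ → ℚ} (h : ∑ a, (c a : ℂ) * reflectedHurwitz k (a : ZMod q) = 0)
    (t : (ZMod q)ˣ) :
    ∑ a, (c a : ℂ) * reflectedHurwitz k (t * a : ZMod q) = 0 := by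
  have hU (u : (ZMod q)ˣ) : ∑ a, (c a : ℂ) * reflectedHurwitz k (u * a : ZMod q) =
      reflectionFactor q k * ∑ a, (c a : ℂ) * bernoulliFourier k (u * a : ZMod q) := by
    rw [Finset.mul_sum]
    refine Finset.sum_congr rfl fun a _ => ?_
    rw [← Units.val_mul, reflectedHurwitz_eq hk (u * a).ne_zero]
    ring
  have h1 := hU 1
  simp only [Units.val_one, one_mul] at h1
  rw [h1, mul_eq_zero_iff_left (reflectionFactor_ne_zero k)] at h
  rw [hU, sum_mul_bernoulliFourier_unit_mul h, mul_zero]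

theorem sum_units_char_mul_reflectedHurwitz (χ : DirichletCharacter ℂ q) (k : ℕ) :
    ∑ t : (ZMod q)ˣ, χ t * reflectedHurwitz k (t : ZMod q) =
      (1 + (-1) ^ k * χ (-1)) * (q ^ k * DirichletCharacter.LFunction χ k) := by
  rw [← sum_char_mul_reflectedHurwitz]
  refine Finset.sum_of_injOn (fun t : (ZMod q)ˣ => (t : ZMod q))
    (fun a _ b _ h => Units.ext h) (fun _ _ => Finset.mem_coe.2 (Finset.mem_univ _)) ?_ ?_
  · intro j _ hj
    rw [MulChar.map_nonunit χ, zero_mul]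
    rintro ⟨u, rfl⟩
    exact hj ⟨u, by simp, rfl⟩
  · intro _ _
    rfl

theorem coeff_add_coeff_neg_eq_zero [Fact (1 < q)] {k : ℕ} (hk : 1 < k) {c : (ZMod q)ˣ → ℚ}
    (h : ∑ a, (c a : ℂ) * reflectedHurwitz k (a : ZMod q) = 0) (b : (ZMod q)ˣ) :
    c b + (-1) ^ k * c (-b) = 0 := by
  have hq : (q : ℂ) ≠ 0 := NeZero.ne _
  have hk1 : (k : ℂ) ≠ 1 := by exact_mod_cast hk.ne'
  have hχ (χ : DirichletCharacter ℂ q) :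
      (∑ a, (c a : ℂ) * χ ((a⁻¹ : (ZMod q)ˣ) : ZMod q)) * (1 + (-1) ^ k * χ (-1)) = 0 := by
    have hL : DirichletCharacter.LFunction χ k ≠ 0 :=
      χ.LFunction_ne_zero_of_one_le_re (Or.inr hk1) (by simpa using hk.le)
    refine (mul_eq_zero_iff_right (mul_ne_zero (pow_ne_zero k hq) hL)).1 ?_
    rw [mul_assoc, ← sum_units_char_mul_reflectedHurwitz]
    calc (∑ a, (c a : ℂ) * χ ((a⁻¹ : (ZMod q)ˣ) : ZMod q)) *
          ∑ t : (ZMod q)ˣ, χ t * reflectedHurwitz k (t : ZMod q)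
        = ∑ a : (ZMod q)ˣ, ∑ t : (ZMod q)ˣ,
            χ t * ((c a : ℂ) * reflectedHurwitz k (t * a : ZMod q)) := by
          rw [Finset.sum_mul]
          refine Finset.sum_congr rfl fun a _ => ?_
          -- Substituting `t * a` for `t` produces a factor `χ a`, which cancels `χ a⁻¹`.
          rw [← Equiv.sum_comp (Equiv.mulRight a), Finset.mul_sum]
          refine Finset.sum_congr rfl fun t _ => ?_
          rw [Equiv.coe_mulRight, Units.val_mul, map_mul]
          have : χ ((a⁻¹ : (ZMod q)ˣ) : ZMod q) * χ a = 1 := by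
            rw [← map_mul, ← Units.val_mul, inv_mul_cancel, Units.val_one, map_one]
          linear_combination ((c a : ℂ) * χ t * reflectedHurwitz k (t * a : ZMod q)) * this
      _ = 0 := by
          rw [Finset.sum_comm]
          refine Finset.sum_eq_zero fun t _ => ?_
          rw [← Finset.mul_sum, sum_mul_reflectedHurwitz_unit_mul hk h t, mul_zero]
  have horth (a b : (ZMod q)ˣ) : ∑ χ : DirichletCharacter ℂ q,
      χ ((a⁻¹ : (ZMod q)ˣ) : ZMod q) * χ b = if a = b then (q.totient : ℂ) else 0 := by
    rw [← ZMod.inv_coe_unit, DirichletCharacter.sum_char_inv_mul_char_eq ℂ a.isUnit]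
    simp only [Units.ext_iff]
  have hdouble (b : (ZMod q)ˣ) : ∑ χ : DirichletCharacter ℂ q,
      (∑ a, (c a : ℂ) * χ ((a⁻¹ : (ZMod q)ˣ) : ZMod q)) * χ b = c b * q.totient := by
    simp only [Finset.sum_mul]
    rw [Finset.sum_comm]
    simp only [mul_assoc, ← Finset.mul_sum, horth]
    simp
  have hsum : ∑ χ : DirichletCharacter ℂ q,
      (∑ a, (c a : ℂ) * χ ((a⁻¹ : (ZMod q)ˣ) : ZMod q)) * (1 + (-1) ^ k * χ (-1)) * χ b = 0 :=
    Finset.sum_eq_zero fun χ _ => by rw [hχ, zero_mul]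
  -- Under character inversion at `b`, the extra factor `χ (-1)` moves the evaluation to `-b`.
  have hsplit : ∑ χ : DirichletCharacter ℂ q,
      (∑ a, (c a : ℂ) * χ ((a⁻¹ : (ZMod q)ˣ) : ZMod q)) * (1 + (-1) ^ k * χ (-1)) * χ b =
      c b * q.totient + (-1) ^ k * (c (-b) * q.totient) := by
    rw [← hdouble, ← hdouble, Finset.mul_sum, ← Finset.sum_add_distrib]
    refine Finset.sum_congr rfl fun χ _ => ?_
    have : χ ((-b : (ZMod q)ˣ) : ZMod q) = χ (-1) * χ b := by
      rw [← map_mul, neg_one_mul, Units.val_neg]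
    rw [this]
    ring
  rw [hsplit] at hsum
  have hφ : (q.totient : ℂ) ≠ 0 := by
    exact_mod_cast (Nat.totient_pos.2 (NeZero.pos q)).ne'
  have hfin : (c b : ℂ) + (-1) ^ k * c (-b) = 0 :=
    (mul_eq_zero_iff_right hφ).1 (by linear_combination hsum)
  exact_mod_cast hfin

end ReflectedHurwitz

/-! ### Linear independence over `ℚ` -/

section RationalIndependence

theorem two_mul_val_ne {q : ℕ} (hq : 2 < q) (u : (ZMod q)ˣ) : 2 * (u : ZMod q).val ≠ q := by
  intro h
  have h1 := ZMod.val_coe_unit_coprime u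
  have h2 : (u : ZMod q).val ∣ q := ⟨2, by omega⟩
  have := Nat.Coprime.eq_one_of_dvd h1 h2
  omega

variable {q : ℕ} [NeZero q]

theorem isAlgebraic_sum {ι : Type*} {s : Finset ι} {f : ι → ℂ}
    (h : ∀ i ∈ s, IsAlgebraic ℚ (f i)) :
    IsAlgebraic ℚ (∑ i ∈ s, f i) :=
  (IsIntegral.sum (R := ℚ) f fun i hi => (h i hi).isIntegral).isAlgebraic

theorem isAlgebraic_bernoulliFourier (k : ℕ) (j : ZMod q) :
    IsAlgebraic ℚ (bernoulliFourier k j) := by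
  refine isAlgebraic_sum fun b _ => IsAlgebraic.mul ?_ (isAlgebraic_algebraMap (bernoulliValue k b))
  have h : IsIntegral ℚ (ZMod.stdAddChar (1 : ZMod q) : ℂ) :=
    (isPrimitiveRoot_stdAddChar_one.isIntegral (NeZero.pos q)).tower_top
  have h2 := stdAddChar_mul_eq_pow (1 : ZMod q) (-(j * b))
  rw [one_mul] at h2
  rw [h2]
  exact (h.isAlgebraic.pow _).pow _

theorem transcendental_reflectionFactor {k : ℕ} (hk : 0 < k) :
    Transcendental ℚ (reflectionFactor q k) := by
  intro h
  have hq : (q : ℂ) ≠ 0 := NeZero.ne _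
  have hf : (k.factorial : ℂ) ≠ 0 := by exact_mod_cast k.factorial_ne_zero
  have hnat (n : ℕ) : IsAlgebraic ℚ (n : ℂ) := isAlgebraic_natCast n
  have hI : IsAlgebraic ℚ Complex.I := by
    refine IsAlgebraic.of_pow (n := 2) two_pos ?_
    rw [Complex.I_sq]
    exact isAlgebraic_one.neg
  have h1 : (Real.pi : ℂ) ^ k = reflectionFactor q k * -((q : ℂ) * k.factorial) *
      (((2 : ℕ) * Complex.I * q) ^ k)⁻¹ := by
    have hI0 := Complex.I_ne_zero
    rw [reflectionFactor]
    push_cast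
    simp only [mul_pow]
    field_simp
  refine transcendental_pi (IsAlgebraic.of_pow hk ?_)
  rw [h1]
  exact (h.mul ((hnat q).mul (hnat _)).neg).mul ((((hnat 2).mul hI).mul (hnat q)).pow k).inv

/-- The units of `ℤ/q` whose least positive representative is smaller than `q/2`. -/
abbrev HalfUnits (q : ℕ) : Type := {u : (ZMod q)ˣ // 2 * (u : ZMod q).val < q}

theorem two_mul_val_neg_lt_iff (hq : 2 < q) (u : (ZMod q)ˣ) :
    2 * ((-u : (ZMod q)ˣ) : ZMod q).val < q ↔ ¬ 2 * (u : ZMod q).val < q := by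
  have : Fact (1 < q) := ⟨by omega⟩
  have : NeZero (u : ZMod q) := ⟨u.ne_zero⟩
  have h1 := two_mul_val_ne hq u
  have h2 := ZMod.val_lt (u : ZMod q)
  rw [Units.val_neg, ZMod.val_neg_of_ne_zero]
  omega

/-- Negation exchanges the two halves of the unit group; no unit sits at `q/2` once `q > 2`. -/
theorem card_halfUnits (hq : 2 < q) : Fintype.card (HalfUnits q) = q.totient / 2 := by
  have h1 : Fintype.card (HalfUnits q) =
      Fintype.card {u : (ZMod q)ˣ // ¬ 2 * (u : ZMod q).val < q} :=
    Fintype.card_congr ((Equiv.neg (ZMod q)ˣ).subtypeEquiv fun u => by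
      rw [Equiv.neg_apply, two_mul_val_neg_lt_iff hq, not_not])
  have h2 := Fintype.card_subtype_compl fun u : (ZMod q)ˣ => 2 * (u : ZMod q).val < q
  have h3 := Fintype.card_subtype_le fun u : (ZMod q)ˣ => 2 * (u : ZMod q).val < q
  rw [ZMod.card_units_eq_totient] at h2 h3
  change Fintype.card (HalfUnits q) ≤ _ at h3
  rw [← h1] at h2
  change _ = _ - Fintype.card (HalfUnits q) at h2
  omega

theorem eq_zero_of_sum_halfUnits_eq_zero (hq : 2 < q) {k : ℕ} (hk : 1 < k) {g : HalfUnits q → ℚ}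
    (h : ∑ u, (g u : ℂ) * reflectedHurwitz k (u.1 : ZMod q) = 0) (u : HalfUnits q) : g u = 0 := by
  have : Fact (1 < q) := ⟨by omega⟩
  -- Extended by zero, the coefficient at `-u` vanishes, so the relation between `c u` and `c (-u)`
  -- kills `c u`.
  let c : (ZMod q)ˣ → ℚ := fun a => if ha : 2 * (a : ZMod q).val < q then g ⟨a, ha⟩ else 0
  have hc : ∑ a, (c a : ℂ) * reflectedHurwitz k (a : ZMod q) = 0 := by
    rw [← h]
    symm
    refine Finset.sum_of_injOn (fun u : HalfUnits q => u.1)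
      (fun a _ b _ h => Subtype.ext h) (fun _ _ => Finset.mem_coe.2 (Finset.mem_univ _)) ?_ ?_
    · intro a _ ha
      have : ¬ 2 * (a : ZMod q).val < q := fun h => ha ⟨⟨a, h⟩, by simp, rfl⟩
      simp [c, this]
    · intro a _
      simp [c, a.2]
  have hu := coeff_add_coeff_neg_eq_zero hk hc u.1
  have hneg : ¬ 2 * ((-u.1 : (ZMod q)ˣ) : ZMod q).val < q := by
    rw [two_mul_val_neg_lt_iff hq, not_not]
    exact u.2
  simpa only [c, dif_pos u.2, dif_neg hneg, mul_zero, add_zero] using hu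

/-- The number `1` together with the reflected Hurwitz values at the half units. -/
noncomputable def extendedFamily (k q : ℕ) [NeZero q] : Option (HalfUnits q) → ℂ
  | none => 1
  | some u => reflectedHurwitz k (u.1 : ZMod q)

theorem linearIndependent_extendedFamily (hq : 2 < q) {k : ℕ} (hk : 1 < k) :
    LinearIndependent ℚ (extendedFamily k q) := by
  have : Fact (1 < q) := ⟨by omega⟩
  rw [Fintype.linearIndependent_iff]
  intro g hg
  rw [Fintype.sum_option] at hg
  simp only [extendedFamily, Rat.smul_def, mul_one] at hg
  -- A nonzero coefficient of `1` would express the transcendental factor as `-g none / A` with `A`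
  -- algebraic.
  have hnone : g none = 0 := by
    by_contra hne
    let A : ℂ := ∑ u : HalfUnits q, (g (some u) : ℂ) * bernoulliFourier k (u.1 : ZMod q)
    have hA : IsAlgebraic ℚ A := isAlgebraic_sum fun u _ =>
      (isAlgebraic_algebraMap (g (some u))).mul (isAlgebraic_bernoulliFourier k _)
    have hsum : ∑ u : HalfUnits q, (g (some u) : ℂ) * reflectedHurwitz k (u.1 : ZMod q) =
        reflectionFactor q k * A := by
      rw [Finset.mul_sum]
      refine Finset.sum_congr rfl fun u _ => ?_
      rw [reflectedHurwitz_eq hk u.1.ne_zero]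
      ring
    rw [hsum] at hg
    have hne' : (g none : ℂ) ≠ 0 := by exact_mod_cast hne
    have hA0 : A ≠ 0 := by
      intro h0
      rw [h0, mul_zero, add_zero] at hg
      exact hne' hg
    refine transcendental_reflectionFactor (q := q) (show 0 < k by omega) ?_
    have : reflectionFactor q k = -(g none : ℂ) * A⁻¹ := by
      rw [eq_mul_inv_iff_mul_eq₀ hA0]
      linear_combination hg
    rw [this]
    exact (isAlgebraic_algebraMap (g none)).neg.mul hA.inv
  rw [hnone, Rat.cast_zero, zero_add] at hg
  intro o
  cases o with
  | none => exact hnone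
  | some u => exact eq_zero_of_sum_halfUnits_eq_zero hq hk (g := fun u => g (some u)) hg u

end RationalIndependence

/-! ### From `ℚ` to `ℚ(i√d)` -/

section ImaginaryQuadratic

theorem exists_rat_of_mem_imagQuadField {d : ℕ} {z : ℂ} (hz : z ∈ imagQuadField d) :
    ∃ r s : ℚ, z = r + s * (Complex.I * (Real.sqrt d : ℂ)) := by
  have hsq : (Complex.I * (Real.sqrt d : ℂ)) ^ 2 = ((-d : ℚ) : ℂ) := by
    rw [mul_pow, Complex.I_sq, ← Complex.ofReal_pow, Real.sq_sqrt d.cast_nonneg]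
    simp
  have halg : IsAlgebraic ℚ (Complex.I * (Real.sqrt d : ℂ)) := by
    refine IsAlgebraic.of_pow two_pos ?_
    rw [hsq]
    exact isAlgebraic_algebraMap (-d : ℚ)
  rw [imagQuadField, ← IntermediateField.mem_toSubalgebra,
    IntermediateField.adjoin_simple_toSubalgebra_of_isAlgebraic halg] at hz
  induction hz using Algebra.adjoin_induction with
  | mem x hx => exact ⟨0, 1, by rw [Set.mem_singleton_iff.1 hx]; simp⟩
  | algebraMap r => exact ⟨r, 0, by simp⟩
  | add x y _ _ hx hy =>
    obtain ⟨r, s, rfl⟩ := hx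
    obtain ⟨r', s', rfl⟩ := hy
    exact ⟨r + r', s + s', by push_cast; ring⟩
  | mul x y _ _ hx hy =>
    obtain ⟨r, s, rfl⟩ := hx
    obtain ⟨r', s', rfl⟩ := hy
    refine ⟨r * r' - s * s' * d, r * s' + s * r', ?_⟩
    push_cast at hsq ⊢
    linear_combination (s * s' : ℂ) * hsq

/-- Writing coefficients as `r + s i√d`, the real and imaginary parts of a relation among real
numbers are two rational relations, the second after removing `√d ≠ 0`. -/
theorem linearIndependent_imagQuadField_of_real {ι : Type*} [Fintype ι] {d : ℕ} (hd : 1 ≤ d)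
    {w : ι → ℝ} (h : LinearIndependent ℚ fun i => (w i : ℂ)) :
    LinearIndependent (imagQuadField d) fun i => (w i : ℂ) := by
  rw [Fintype.linearIndependent_iff] at h ⊢
  intro g hg
  choose r s hrs using fun i => exists_rat_of_mem_imagQuadField (g i).2
  have hd0 : (Real.sqrt d : ℂ) ≠ 0 :=
    Complex.ofReal_ne_zero.2 (Real.sqrt_ne_zero'.2 (by exact_mod_cast hd))
  have hsplit : ((∑ i, (r i : ℝ) * w i : ℝ) : ℂ) +
      ((Real.sqrt d * ∑ i, (s i : ℝ) * w i : ℝ) : ℂ) * Complex.I = 0 := by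
    rw [← hg, Finset.mul_sum]
    push_cast
    rw [Finset.sum_mul, ← Finset.sum_add_distrib]
    refine Finset.sum_congr rfl fun i _ => ?_
    rw [IntermediateField.smul_def, smul_eq_mul, hrs i]
    ring
  have hre := congrArg Complex.re hsplit
  have him := congrArg Complex.im hsplit
  simp only [Complex.add_re, Complex.add_im, Complex.re_ofReal_mul, Complex.im_ofReal_mul,
    Complex.I_re, Complex.I_im, Complex.ofReal_re, Complex.ofReal_im, mul_zero, add_zero,
    mul_one, zero_add, Complex.zero_re, Complex.zero_im] at hre him
  have hd0' : Real.sqrt d ≠ 0 := Complex.ofReal_ne_zero.1 hd0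
  rw [mul_eq_zero_iff_left hd0'] at him
  have hrat (c : ι → ℚ) (hc : ∑ i, (c i : ℝ) * w i = 0) : ∀ i, c i = 0 := by
    refine h c ?_
    simp only [Rat.smul_def]
    exact_mod_cast congrArg Complex.ofReal hc
  intro i
  apply Subtype.ext
  rw [hrs i, hrat r hre i, hrat s him i]
  simp

end ImaginaryQuadratic

/-! ### Identification of the spaces and their dimensions -/

section DimensionBounds

variable {q : ℕ} [NeZero q]

theorem zetaH_eq_ofReal {k : ℕ} (hk : 1 < k) {x : ℝ} (hx : x ∈ Set.Ioc (0 : ℝ) 1) :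
    zetaH k x = ((∑' n : ℕ, 1 / ((n : ℝ) + x) ^ k : ℝ) : ℂ) := by
  rw [← (hasSum_zetaH (s := k) (by simpa using hk) hx).tsum_eq, Complex.ofReal_tsum]
  refine tsum_congr fun n => ?_
  rw [Complex.cpow_natCast]
  push_cast
  rfl

theorem reflectedHurwitz_natCast (k a : ℕ) :
    reflectedHurwitz k (a : ZMod q) =
      zetaH k ((a : ℝ) / q) + (-1) ^ k * zetaH k (1 - (a : ℝ) / q) := by
  have h : ZMod.toAddCircle (-(a : ZMod q)) = ((1 - (a : ℝ) / q : ℝ) : UnitAddCircle) := by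
    rw [map_neg, ZMod.toAddCircle_natCast, AddCircle.coe_sub, AddCircle.coe_period, zero_sub]
  rw [reflectedHurwitz, h, ZMod.toAddCircle_natCast]
  rfl

theorem exists_real_eq_reflectedHurwitz {k : ℕ} (hk : 1 < k) {j : ZMod q} (hj : j ≠ 0) :
    ∃ r : ℝ, reflectedHurwitz k j = r := by
  have hq : (0 : ℝ) < q := Nat.cast_pos.2 (NeZero.pos q)
  have hpos : (0 : ℝ) < j.val := Nat.cast_pos.2 (Nat.pos_of_ne_zero ((ZMod.val_ne_zero j).2 hj))
  have hlt : (j.val : ℝ) / q < 1 := (div_lt_one hq).2 (by exact_mod_cast ZMod.val_lt j)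
  have hdiv : 0 < (j.val : ℝ) / q := div_pos hpos hq
  rw [← ZMod.natCast_zmod_val j, reflectedHurwitz_natCast, zetaH_eq_ofReal hk ⟨hdiv, hlt.le⟩,
    zetaH_eq_ofReal hk ⟨by linarith, by linarith⟩]
  exact ⟨(∑' n : ℕ, 1 / ((n : ℝ) + (j.val : ℝ) / q) ^ k) +
    (-1) ^ k * ∑' n : ℕ, 1 / ((n : ℝ) + (1 - (j.val : ℝ) / q)) ^ k, by push_cast; rfl⟩

theorem linearIndependent_imagQuadField_extendedFamily (hq : 2 < q) {k d : ℕ} (hk : 1 < k)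
    (hd : 1 ≤ d) : LinearIndependent (imagQuadField d) (extendedFamily k q) := by
  have : Fact (1 < q) := ⟨by omega⟩
  have hreal : ∀ o, ∃ r : ℝ, extendedFamily k q o = r
    | none => ⟨1, by simp [extendedFamily]⟩
    | some u => exists_real_eq_reflectedHurwitz hk u.1.ne_zero
  choose w hw using hreal
  have h := linearIndependent_extendedFamily hq hk
  rw [funext hw] at h ⊢
  exact linearIndependent_imagQuadField_of_real hd h

theorem arithmeticSpace_eq_span (k : ℕ) (hq : 2 < q) (K : IntermediateField ℚ ℂ) :
    arithmeticSpace k q K = Submodule.span K (Set.range (extendedFamily k q ∘ some)) := by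
  rw [arithmeticSpace]
  congr 1
  ext z
  constructor
  · rintro ⟨a, ha, haq, hcop, rfl⟩
    have haq' : 2 * a < q := by
      have : 2 * (a : ℝ) < q := by linarith
      exact_mod_cast this
    refine ⟨⟨ZMod.unitOfCoprime a hcop, ?_⟩, ?_⟩
    · rwa [ZMod.coe_unitOfCoprime, ZMod.val_cast_of_lt (by omega)]
    · change reflectedHurwitz k (ZMod.unitOfCoprime a hcop : ZMod q) = _
      rw [ZMod.coe_unitOfCoprime, reflectedHurwitz_natCast]
  · rintro ⟨u, rfl⟩
    have : Fact (1 < q) := ⟨by omega⟩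
    refine ⟨(u.1 : ZMod q).val,
      Nat.one_le_iff_ne_zero.2 ((ZMod.val_ne_zero _).2 u.1.ne_zero), ?_,
      ZMod.val_coe_unit_coprime u.1, ?_⟩
    · have : 2 * ((u.1 : ZMod q).val : ℝ) < q := by exact_mod_cast u.2
      linarith
    · rw [← reflectedHurwitz_natCast, ZMod.natCast_zmod_val]
      rfl

/-- Needed for monotonicity of `finrank`, which is 0 by default in infinite dimension. -/
theorem finite_extendedSpace (k q : ℕ) (K : IntermediateField ℚ ℂ) :
    Module.Finite K (extendedSpace k q K) := by
  refine FiniteDimensional.span_of_finite K ((Set.finite_singleton _).union ?_)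
  refine ((Set.finite_lt_nat q).image fun a : ℕ => zetaH k ((a : ℝ) / q)).subset ?_
  rintro z ⟨a, -, ha, -, rfl⟩
  exact ⟨a, ha, rfl⟩

theorem extendedFamily_mem_extendedSpace (k : ℕ) (hq : 2 < q) (K : IntermediateField ℚ ℂ) :
    ∀ o, extendedFamily k q o ∈ extendedSpace k q K
  | none => Submodule.subset_span (Or.inl rfl)
  | some u => by
    have : Fact (1 < q) := ⟨by omega⟩
    have hmem (v : (ZMod q)ˣ) : zetaH k (((v : ZMod q).val : ℝ) / q) ∈ extendedSpace k q K :=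
      Submodule.subset_span (Or.inr ⟨(v : ZMod q).val,
        Nat.one_le_iff_ne_zero.2 ((ZMod.val_ne_zero _).2 v.ne_zero), ZMod.val_lt _,
        ZMod.val_coe_unit_coprime v, rfl⟩)
    -- `1 - a/q` is again of the form `a'/q` with `a'` coprime to `q`, namely the representative of
    -- `-a`.
    have heq : extendedFamily k q (some u) = zetaH k (((u.1 : ZMod q).val : ℝ) / q) +
        ((-1) ^ k : K) • zetaH k ((((-u.1 : (ZMod q)ˣ) : ZMod q).val : ℝ) / q) := by
      rw [IntermediateField.smul_def, smul_eq_mul, zetaH, zetaH, ← toAddCircle_eq_val_div,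
        ← toAddCircle_eq_val_div]
      simp [extendedFamily, reflectedHurwitz]
    rw [heq]
    exact add_mem (hmem _) (Submodule.smul_mem _ _ (hmem _))

end DimensionBounds

end HurwitzSpaces

theorem theorem4p3 (k q d : ℕ) (hk : 1 < k) (hq : 2 < q) (hd1 : 1 ≤ d) (hd : Squarefree d)
    (hK : HurwitzSpaces.imagQuadField d ⊓ HurwitzSpaces.cyclotomicSubfield q =
      HurwitzSpaces.imagQuadField d) :
    Module.finrank (HurwitzSpaces.imagQuadField d)
        (HurwitzSpaces.arithmeticSpace k q (HurwitzSpaces.imagQuadField d)) = Nat.totient q / 2 ∧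
      Nat.totient q / 2 + 1 ≤
        Module.finrank (HurwitzSpaces.imagQuadField d)
          (HurwitzSpaces.extendedSpace k q (HurwitzSpaces.imagQuadField d)) := by
  have : NeZero q := ⟨by omega⟩
  have hli := HurwitzSpaces.linearIndependent_imagQuadField_extendedFamily hq hk hd1
  constructor
  · rw [HurwitzSpaces.arithmeticSpace_eq_span k hq,
      finrank_span_eq_card (hli.comp some (Option.some_injective _)),
      HurwitzSpaces.card_halfUnits hq]
  · have hfin := HurwitzSpaces.finite_extendedSpace k q (HurwitzSpaces.imagQuadField d)
    have hle : Submodule.span (HurwitzSpaces.imagQuadField d)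
        (Set.range (HurwitzSpaces.extendedFamily k q)) ≤
        HurwitzSpaces.extendedSpace k q (HurwitzSpaces.imagQuadField d) :=
      Submodule.span_le.2 (Set.range_subset_iff.2
        (HurwitzSpaces.extendedFamily_mem_extendedSpace k hq _))
    rw [← HurwitzSpaces.card_halfUnits hq, ← Fintype.card_option, ← finrank_span_eq_card hli]
    exact Submodule.finrank_mono hle
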